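/- Let $d\ge 1$ and let $\Omega\subset\mathbb R^d$ be a bounded open set (for instance a bounded smooth domain). Let $H^1(\Omega)$ be the space of $L^2(\Omega)$ functions with weak gradient in $[L^2(\Omega)]^d$, let $H^1_0(\Omega)$ be the closure of $C_c^\infty(\Omega)$ in $H^1(\Omega)$, let $H^{-1}(\Omega)=H^1_0(\Omega)'$, and let $H^{1/2}(\partial\Omega)=H^1(\Omega)/H^1_0(\Omega)$ be the space of boundary values $y_{|\partial\Omega}$ of functions $y\in H^1(\Omega)$ (for a bounded smooth domain this is the usual trace space). Let $L^\infty_F(\Omega)$ be a finite-dimensional subspace of $L^\infty(\Omega)$, of dimension $n_1$, identified with $\mathbb R^{n_1}$ by the choice of a basis. For $M>m>0$ let $$\mathcal U_{m,M}=\{u\in L^\infty_F(\Omega)\mid m\le u(x)\le M\text{ for a.e. }x\in\Omega\},$$ and assume that $\mathcal U_{m,M}\neq\emptyset$. Let $f\in H^{-1}(\Omega)$, $g\in H^{1/2}(\partial\Omega)$ and $y_d\in L^2(\Omega)$. Let $L\ge 1$ and let $n_2,\dots,n_{L+1}$ be dimensions. Let $\rho:\mathbb R\to\mathbb R$ be of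 class $C^2$ and $\gamma:\mathbb R^{n_{L+1}}\to\mathbb R$ be continuous (for instance smooth, or a norm). For a family of weights $w=(w_1,\dots,w_L)\in\mathcal W=\prod_{\ell=1}^L \mathrm{Aff}(\mathbb R^{n_\ell},\mathbb R^{n_{\ell+1}})$ let $$r(w,u)=w_L(\rho(w_{L-1}(\rho(\cdots\rho(w_1(u))))))\in\mathbb R^{n_{L+1}},$$ where $\rho$ is applied coordinatewise (and $r(w,u)=w_1(u)$ if $L=1$). Then for every $w\in\mathcal W$ the problem $$\min_{(y,u)\in H^1(\Omega)\times\mathcal U_{m,M}} J(y,u,w)=\tfrac12\|y-y_d\|_{L^2(\Omega)}^2+\gamma(r(w,u))$$ subject to $$-\operatorname{div}(u\nabla y)=f\ \text{ in } H^{-1}(\Omega),\qquad y_{|\partial\Omega}=g,$$ the first equation meaning $\int_\Omega u\,\nabla y\cdot\nabla\varphi\,dx=\langle f,\varphi\rangle$ for all $\varphi\in H^1_0(\Omega)$, admits a global minimizer: there is a pair $(y,u)\in H^1(\Omega)\times\mathcal U_{m,M}$ satisfying the constraints such that $J(y,u,w)\le J(y',u',w)$ for all pairs $(y',u')\in H^1(\Omega)\times\mathcal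 U_{m,M}$ satisfying the constraints. -/

import Mathlib

open MeasureTheory
open scoped ENNReal ContDiff

noncomputable section

namespace Conductivity

variable {d : ℕ}

/-- Lebesgue measure on `Ω ⊆ ℝ^d`. -/
abbrev vol (Ω : Set (EuclideanSpace ℝ (Fin d))) : Measure (EuclideanSpace ℝ (Fin d)) :=
  volume.restrict Ω

/-- `L²(Ω)`. -/
abbrev L2 (Ω : Set (EuclideanSpace ℝ (Fin d))) : Type := Lp ℝ 2 (vol Ω)

/-- `[L²(Ω)]^d`. -/
abbrev L2vec (Ω : Set (EuclideanSpace ℝ (Fin d))) : Type :=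
  Lp (EuclideanSpace ℝ (Fin d)) 2 (vol Ω)

/-- `L^∞(Ω)`. -/
abbrev Linf (Ω : Set (EuclideanSpace ℝ (Fin d))) : Type := Lp ℝ ∞ (vol Ω)

/-- `φ ∈ C_c^∞(Ω)`. -/
structure IsTest (Ω : Set (EuclideanSpace ℝ (Fin d))) (φ : EuclideanSpace ℝ (Fin d) → ℝ) :
    Prop where
  smooth : ContDiff ℝ ∞ φ
  compact : HasCompactSupport φ
  supp : tsupport φ ⊆ Ω

/-- The partial derivative `∂ᵢ φ`. -/
def partialDeriv (i : Fin d) (φ : EuclideanSpace ℝ (Fin d) → ℝ) (x : EuclideanSpace ℝ (Fin d)) :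
    ℝ :=
  fderiv ℝ φ x (EuclideanSpace.single i 1)

/-- `v` is the weak gradient of `y` in `Ω`. -/
def HasWeakGradient (Ω : Set (EuclideanSpace ℝ (Fin d))) (y : L2 Ω) (v : L2vec Ω) : Prop :=
  ∀ φ, IsTest Ω φ → ∀ i : Fin d,
    ∫ x in Ω, y x * partialDeriv i φ x = - ∫ x in Ω, v x i * φ x

theorem IsTest.memLp {Ω : Set (EuclideanSpace ℝ (Fin d))} {φ : EuclideanSpace ℝ (Fin d) → ℝ}
    (h : IsTest Ω φ) : MemLp φ 2 (vol Ω) :=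
  (h.smooth.continuous.memLp_of_hasCompactSupport h.compact).restrict Ω

theorem IsTest.partialDeriv_memLp {Ω : Set (EuclideanSpace ℝ (Fin d))}
    {φ : EuclideanSpace ℝ (Fin d) → ℝ} (h : IsTest Ω φ) (i : Fin d) :
    MemLp (partialDeriv i φ) 2 (vol Ω) :=
  (((h.smooth.continuous_fderiv (by simp)).clm_apply
    continuous_const).memLp_of_hasCompactSupport (h.compact.fderiv_apply ℝ _)).restrict Ω

theorem memLp_coord {Ω : Set (EuclideanSpace ℝ (Fin d))} (v : L2vec Ω) (i : Fin d) :
    MemLp (fun x => v x i) 2 (vol Ω) :=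
  (EuclideanSpace.proj (𝕜 := ℝ) i : EuclideanSpace ℝ (Fin d) →L[ℝ] ℝ).comp_memLp' (Lp.memLp v)

theorem HasWeakGradient.zero (Ω : Set (EuclideanSpace ℝ (Fin d))) :
    HasWeakGradient Ω 0 0 := by
  intro φ _ i
  have h1 : ∫ x in Ω, (0 : L2 Ω) x * partialDeriv i φ x = 0 := by
    rw [← integral_zero (μ := vol Ω) (G := ℝ)]
    refine integral_congr_ae ?_
    filter_upwards [Lp.coeFn_zero ℝ 2 (vol Ω)] with x hx
    rw [hx]
    simp
  have h2 : ∫ x in Ω, (0 : L2vec Ω) x i * φ x = 0 := by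
    rw [← integral_zero (μ := vol Ω) (G := ℝ)]
    refine integral_congr_ae ?_
    filter_upwards [Lp.coeFn_zero (EuclideanSpace ℝ (Fin d)) 2 (vol Ω)] with x hx
    rw [hx]
    simp
  rw [h1, h2, neg_zero]

theorem HasWeakGradient.add {Ω : Set (EuclideanSpace ℝ (Fin d))} {y z : L2 Ω} {v w : L2vec Ω}
    (h : HasWeakGradient Ω y v) (k : HasWeakGradient Ω z w) :
    HasWeakGradient Ω (y + z) (v + w) := by
  intro φ hφ i
  have h1 : ∫ x in Ω, (y + z) x * partialDeriv i φ x =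
      ∫ x in Ω, y x * partialDeriv i φ x + z x * partialDeriv i φ x := by
    refine integral_congr_ae ?_
    filter_upwards [Lp.coeFn_add y z] with x hx
    rw [hx]
    simp [add_mul]
  have h2 : ∫ x in Ω, (v + w) x i * φ x = ∫ x in Ω, v x i * φ x + w x i * φ x := by
    refine integral_congr_ae ?_
    filter_upwards [Lp.coeFn_add v w] with x hx
    rw [hx]
    simp [add_mul]
  have i1 : Integrable (fun x => y x * partialDeriv i φ x) (vol Ω) :=
    (Lp.memLp y).integrable_mul (hφ.partialDeriv_memLp i)
  have i2 : Integrable (fun x => z x * partialDeriv i φ x) (vol Ω) :=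
    (Lp.memLp z).integrable_mul (hφ.partialDeriv_memLp i)
  have i3 : Integrable (fun x => v x i * φ x) (vol Ω) :=
    (memLp_coord v i).integrable_mul hφ.memLp
  have i4 : Integrable (fun x => w x i * φ x) (vol Ω) :=
    (memLp_coord w i).integrable_mul hφ.memLp
  rw [h1, h2, integral_add i1 i2, integral_add i3 i4, h φ hφ i, k φ hφ i]
  ring

theorem HasWeakGradient.smul {Ω : Set (EuclideanSpace ℝ (Fin d))} {y : L2 Ω} {v : L2vec Ω}
    (c : ℝ) (h : HasWeakGradient Ω y v) : HasWeakGradient Ω (c • y) (c • v) := by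
  intro φ hφ i
  have h1 : ∫ x in Ω, (c • y) x * partialDeriv i φ x =
      ∫ x in Ω, c * (y x * partialDeriv i φ x) := by
    refine integral_congr_ae ?_
    filter_upwards [Lp.coeFn_smul c y] with x hx
    simp [hx, mul_assoc]
  have h2 : ∫ x in Ω, (c • v) x i * φ x = ∫ x in Ω, c * (v x i * φ x) := by
    refine integral_congr_ae ?_
    filter_upwards [Lp.coeFn_smul c v] with x hx
    simp [hx, mul_assoc]
  rw [h1, h2, integral_const_mul, integral_const_mul, h φ hφ i]
  ring

/-- The Sobolev space `H¹(Ω)`: the functions of `L²(Ω)` with a weak gradient in `[L²(Ω)]^d`. An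
element is stored as the pair `(y, ∇y)`, the second entry being determined by the first; the norm
is `(‖y‖² + ‖∇y‖²)^{1/2}`. -/
def H1 (Ω : Set (EuclideanSpace ℝ (Fin d))) : Submodule ℝ (WithLp 2 (L2 Ω × L2vec Ω)) where
  carrier := {p | HasWeakGradient Ω p.fst p.snd}
  zero_mem' := HasWeakGradient.zero Ω
  add_mem' h k := HasWeakGradient.add h k
  smul_mem' c _ h := HasWeakGradient.smul c h

/-- The embedding `H¹(Ω) → L²(Ω)`. -/
def H1.val {Ω : Set (EuclideanSpace ℝ (Fin d))} (y : H1 Ω) : L2 Ω := y.1.fst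

/-- The weak gradient `H¹(Ω) → [L²(Ω)]^d`. -/
def H1.grad {Ω : Set (EuclideanSpace ℝ (Fin d))} (y : H1 Ω) : L2vec Ω := y.1.snd

/-- `C_c^∞(Ω)` as a subspace of `H¹(Ω)`. -/
def testSubmodule (Ω : Set (EuclideanSpace ℝ (Fin d))) : Submodule ℝ (H1 Ω) where
  carrier := {y | ∃ φ, IsTest Ω φ ∧ (∀ᵐ x ∂vol Ω, H1.val y x = φ x) ∧
    ∀ᵐ x ∂vol Ω, ∀ i, H1.grad y x i = partialDeriv i φ x}
  zero_mem' := by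
    refine ⟨0, ⟨contDiff_const, HasCompactSupport.zero, by simp [tsupport]⟩, ?_, ?_⟩
    · filter_upwards [Lp.coeFn_zero ℝ 2 (vol Ω)] with x hx
      exact hx
    · filter_upwards [Lp.coeFn_zero (EuclideanSpace ℝ (Fin d)) 2 (vol Ω)] with x hx i
      have : (H1.grad (0 : H1 Ω)) x = 0 := hx
      simp [this, partialDeriv]
  add_mem' := by
    rintro y z ⟨φ, hφ, hy, hy'⟩ ⟨ψ, hψ, hz, hz'⟩
    refine ⟨φ + ψ, ⟨hφ.smooth.add hψ.smooth, hφ.compact.add hψ.compact,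
      (tsupport_add φ ψ).trans (Set.union_subset hφ.supp hψ.supp)⟩, ?_, ?_⟩
    · filter_upwards [Lp.coeFn_add (H1.val y) (H1.val z), hy, hz] with x hx h k
      have : H1.val (y + z) x = (⇑(H1.val y) + ⇑(H1.val z)) x := hx
      simp [this, h, k]
    · filter_upwards [Lp.coeFn_add (H1.grad y) (H1.grad z), hy', hz'] with x hx h k i
      have : H1.grad (y + z) x = (⇑(H1.grad y) + ⇑(H1.grad z)) x := hx
      have e : fderiv ℝ (φ + ψ) x = fderiv ℝ φ x + fderiv ℝ ψ x :=
        fderiv_add (hφ.smooth.differentiable (by simp) x) (hψ.smooth.differentiable (by simp) x)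
      simp only [this, partialDeriv, e]
      simp [h, k, partialDeriv]
  smul_mem' := by
    rintro c y ⟨φ, hφ, hy, hy'⟩
    refine ⟨c • φ, ⟨hφ.smooth.const_smul c, hφ.compact.smul_left (f := fun _ => c),
      (tsupport_smul_subset_right (fun _ => c) φ).trans hφ.supp⟩, ?_, ?_⟩
    · filter_upwards [Lp.coeFn_smul c (H1.val y), hy] with x hx h
      have : H1.val (c • y) x = (c • ⇑(H1.val y)) x := hx
      simp [this, h]
    · filter_upwards [Lp.coeFn_smul c (H1.grad y), hy'] with x hx h i
      have : H1.grad (c • y) x = (c • ⇑(H1.grad y)) x := hx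
      have e : fderiv ℝ (c • φ) x = c • fderiv ℝ φ x :=
        fderiv_const_smul (hφ.smooth.differentiable (by simp) x) c
      simp only [this, partialDeriv, e]
      simp [h, partialDeriv]

/-- `H¹₀(Ω)`: the closure of `C_c^∞(Ω)` in `H¹(Ω)`. -/
def H10 (Ω : Set (EuclideanSpace ℝ (Fin d))) : Submodule ℝ (H1 Ω) :=
  (testSubmodule Ω).topologicalClosure

/-- `H⁻¹(Ω)`: the topological dual of `H¹₀(Ω)`. -/
abbrev Hneg1 (Ω : Set (EuclideanSpace ℝ (Fin d))) : Type := H10 Ω →L[ℝ] ℝ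

/-- `H^{1/2}(∂Ω)`: the space of boundary values of `H¹(Ω)` functions, two functions having the same
boundary values when their difference lies in `H¹₀(Ω)`. -/
abbrev HHalf (Ω : Set (EuclideanSpace ℝ (Fin d))) : Type := H1 Ω ⧸ H10 Ω

/-- The trace `y ↦ y|_{∂Ω}`. -/
def trace (Ω : Set (EuclideanSpace ℝ (Fin d))) : H1 Ω →ₗ[ℝ] HHalf Ω := (H10 Ω).mkQ

/-- `y` solves `-div(u ∇y) = f` in `H⁻¹(Ω)` and `y = g` on `∂Ω`. -/
def IsState {Ω : Set (EuclideanSpace ℝ (Fin d))} (f : Hneg1 Ω) (g : HHalf Ω) (u : Linf Ω)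
    (y : H1 Ω) : Prop :=
  (∀ φ : H10 Ω, ∫ x in Ω, u x * inner ℝ (H1.grad y x) (H1.grad (φ : H1 Ω) x) = f φ) ∧
    trace Ω y = g

/-- `𝒰_{m,M}`: the elements `u` of the given subspace of `L^∞(Ω)` with `m ≤ u ≤ M` a.e. -/
def admissible {Ω : Set (EuclideanSpace ℝ (Fin d))} (F : Submodule ℝ (Linf Ω)) (m M : ℝ) : Set F :=
  {u | ∀ᵐ x ∂vol Ω, m ≤ (u : Linf Ω) x ∧ (u : Linf Ω) x ≤ M}

/-- The weights of a network with `N` layers and layer dimensions `n 0, …, n N`: one affine map per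
layer. -/
abbrev Weights (N : ℕ) (n : ℕ → ℕ) : Type :=
  ∀ l : Fin N, (Fin (n l) → ℝ) →ᵃ[ℝ] (Fin (n (l + 1)) → ℝ)

/-- The first `l + 1` layers of the network: `w_{l+1}(ρ(w_l(ρ(… ρ(w_1(z))))))`, with `ρ` applied
coordinatewise. -/
def partialNetwork {N : ℕ} {n : ℕ → ℕ} (ρ : ℝ → ℝ) (w : Weights N n) :
    (l : ℕ) → l < N → (Fin (n 0) → ℝ) → (Fin (n (l + 1)) → ℝ)
  | 0, h, z => w ⟨0, h⟩ z
  | l + 1, h, z => w ⟨l + 1, h⟩ fun i => ρ (partialNetwork ρ w l (Nat.lt_of_succ_lt h) z i)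

/-- The feedforward network with `L + 1 ≥ 1` layers. -/
def network {L : ℕ} {n : ℕ → ℕ} (ρ : ℝ → ℝ) (w : Weights (L + 1) n) (z : Fin (n 0) → ℝ) :
    Fin (n (L + 1)) → ℝ :=
  partialNetwork ρ w L (Nat.lt_succ_self L) z

/-- The regularizer `r(w, ·)` on the finite-dimensional control space `F`, which is identified with
`ℝ^{n 0}` through the basis `b`. -/
def regularizer {Ω : Set (EuclideanSpace ℝ (Fin d))} {F : Submodule ℝ (Linf Ω)} {L : ℕ}
    {n : ℕ → ℕ} (b : Module.Basis (Fin (n 0)) ℝ F) (ρ : ℝ → ℝ) (w : Weights (L + 1) n) (u : F) :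
    Fin (n (L + 1)) → ℝ :=
  network ρ w (b.equivFun u)

/-- The pairs `(y, u) ∈ H¹(Ω) × 𝒰_{m,M}` satisfying the state equation. -/
def feasible {Ω : Set (EuclideanSpace ℝ (Fin d))} (F : Submodule ℝ (Linf Ω)) (m M : ℝ)
    (f : Hneg1 Ω) (g : HHalf Ω) : Set (H1 Ω × F) :=
  {p | p.2 ∈ admissible F m M ∧ IsState f g (p.2 : Linf Ω) p.1}

/-- `J(y, u, w) = ½ ‖y - y_d‖²_{L²(Ω)} + γ(r(w, u))`. -/
def cost {Ω : Set (EuclideanSpace ℝ (Fin d))} {F : Submodule ℝ (Linf Ω)} {L : ℕ} {n : ℕ → ℕ}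
    (b : Module.Basis (Fin (n 0)) ℝ F) (ρ : ℝ → ℝ) (γ : (Fin (n (L + 1)) → ℝ) → ℝ) (yd : L2 Ω)
    (w : Weights (L + 1) n) (p : H1 Ω × F) : ℝ :=
  1 / 2 * ‖H1.val p.1 - yd‖ ^ 2 + γ (regularizer b ρ w p.2)

end Conductivity

end

/-!
For coefficients `u ≥ m > 0` the operator `z ↦ -div(u ∇z)` from `H¹₀(Ω)` to `H⁻¹(Ω)` is coercive by
Poincaré's inequality, hence invertible by Lax–Milgram. It is linear in `u`, and inversion is
continuous on invertible operators, so the state `y` is a continuous function of `u` in the `H¹`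
norm. The set of admissible `u` is an order interval of `L^∞(Ω)` intersected with a
finite-dimensional subspace, hence compact. The feasible set is the graph of the control-to-state
map over it, so it is compact too, and every lower semicontinuous cost attains its minimum there.
-/

noncomputable section

namespace Conductivity

section LaxMilgram

variable {V : Type*} [NormedAddCommGroup V] [InnerProductSpace ℝ V] [CompleteSpace V]

theorem isInvertible_of_isCoercive {B : V →L[ℝ] V →L[ℝ] ℝ} (hB : IsCoercive B) :
    B.IsInvertible := by
  refine ⟨hB.continuousLinearEquivOfBilin.trans
    (InnerProductSpace.toDual ℝ V).toContinuousLinearEquiv, ?_⟩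
  ext v w
  exact hB.continuousLinearEquivOfBilin_apply v w

end LaxMilgram

section Lattice

variable {α : Type*} [NormedAddCommGroup α] [Lattice α] [IsOrderedAddMonoid α] [HasSolidNorm α]

theorem isBounded_Icc_of_hasSolidNorm (a b : α) : Bornology.IsBounded (Set.Icc a b) := by
  refine Metric.isBounded_closedBall (x := a) (r := ‖b - a‖) |>.subset fun x hx => ?_
  rw [mem_closedBall_iff_norm]
  refine norm_le_norm_of_abs_le_abs ?_
  rw [abs_of_nonneg (sub_nonneg.2 hx.1), abs_of_nonneg (sub_nonneg.2 (hx.1.trans hx.2))]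
  exact sub_le_sub_right hx.2 a

theorem isCompact_subtype_val_preimage_Icc [NormedSpace ℝ α] (F : Submodule ℝ α)
    [FiniteDimensional ℝ F] (a b : α) : IsCompact ((↑) ⁻¹' Set.Icc a b : Set F) := by
  have : ProperSpace F := FiniteDimensional.proper ℝ F
  refine Metric.isCompact_of_isClosed_isBounded (isClosed_Icc.preimage continuous_subtype_val) ?_
  exact isometry_subtype_coe.antilipschitz.isBounded_preimage (isBounded_Icc_of_hasSolidNorm a b)

end Lattice

section Lp

variable {α : Type*} [MeasurableSpace α] {μ : Measure α}

theorem continuous_integral_bilin {p q : ℝ≥0∞} [Fact (1 ≤ p)] [Fact (1 ≤ q)]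
    [ENNReal.HolderConjugate p q] {E F : Type*} [NormedAddCommGroup E] [NormedSpace ℝ E]
    [NormedAddCommGroup F] [NormedSpace ℝ F] (B : E →L[ℝ] F →L[ℝ] ℝ) {g : α → F}
    (hg : MemLp g q μ) : Continuous fun f : Lp E p μ => ∫ x, B (f x) (g x) ∂μ := by
  have hpair (f : Lp E p μ) : B.lpPairing μ p q f hg.toLp = ∫ x, B (f x) (g x) ∂μ := by
    rw [B.lpPairing_eq_integral]
    refine integral_congr_ae ?_
    filter_upwards [hg.coeFn_toLp] with x hx
    rw [hx]
  simp only [← hpair]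
  fun_prop

variable {E : Type*} [NormedAddCommGroup E] [InnerProductSpace ℝ E]

theorem norm_sq_eq_integral_norm_sq (v : Lp E 2 μ) : ‖v‖ ^ 2 = ∫ x, ‖v x‖ ^ 2 ∂μ := by
  rw [← real_inner_self_eq_norm_sq, L2.inner_def]
  simp only [real_inner_self_eq_norm_sq]

/-- Multiplication of `L²` functions by `L^∞` functions, as a continuous bilinear map. -/
def mulL (μ : Measure α) (E : Type*) [NormedAddCommGroup E] [InnerProductSpace ℝ E] :
    Lp ℝ ∞ μ →L[ℝ] Lp E 2 μ →L[ℝ] Lp E 2 μ :=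
  (ContinuousLinearMap.lsmul ℝ ℝ).holderL μ ∞ 2 2

theorem inner_mulL (u : Lp ℝ ∞ μ) (v w : Lp E 2 μ) :
    inner ℝ (mulL μ E u v) w = ∫ x, u x * inner ℝ (v x) (w x) ∂μ := by
  rw [L2.inner_def]
  refine integral_congr_ae ?_
  filter_upwards [(ContinuousLinearMap.lsmul ℝ ℝ).coeFn_holder (r := 2) u v] with x hx
  rw [show mulL μ E u v x = u x • v x from hx, real_inner_smul_left]

theorem mul_norm_sq_le_inner_mulL_self {m : ℝ} {u : Lp ℝ ∞ μ} (hu : ∀ᵐ x ∂μ, m ≤ u x)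
    (v : Lp E 2 μ) : m * ‖v‖ ^ 2 ≤ inner ℝ (mulL μ E u v) v := by
  rw [norm_sq_eq_integral_norm_sq, L2.inner_def, ← integral_const_mul]
  refine integral_mono_ae ((Lp.memLp v).norm.integrable_sq.const_mul m)
    (L2.integrable_inner (𝕜 := ℝ) _ _) ?_
  filter_upwards [(ContinuousLinearMap.lsmul ℝ ℝ).coeFn_holder (r := 2) u v, hu] with x hx hux
  rw [show mulL μ E u v x = u x • v x from hx, real_inner_smul_left, real_inner_self_eq_norm_sq]
  exact mul_le_mul_of_nonneg_right hux (sq_nonneg _)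

end Lp

section Poincare

theorem integrable_of_forall_eq_zero_imp {X : Type*} [TopologicalSpace X] [MeasurableSpace X]
    [OpensMeasurableSpace X] {μ : Measure X} [IsFiniteMeasureOnCompacts μ] {φ ψ : X → ℝ}
    (hψ : Continuous ψ) (hφ : HasCompactSupport φ) (h : ∀ x, φ x = 0 → ψ x = 0) :
    Integrable ψ μ :=
  hψ.integrable_of_hasCompactSupport (hφ.mono fun x hx hx' => hx (h x hx'))

variable {E : Type*} [NormedAddCommGroup E] [NormedSpace ℝ E] [FiniteDimensional ℝ E]
  [MeasurableSpace E] [BorelSpace E] {μ : Measure E} [μ.IsAddHaarMeasure] {φ : E → ℝ}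

theorem integral_sq_eq_neg_integral_mul_fderiv (hφ : ContDiff ℝ 1 φ) (hc : HasCompactSupport φ)
    {ℓ : E →L[ℝ] ℝ} {v : E} (hv : ℓ v = 1) :
    ∫ x, φ x ^ 2 ∂μ = -∫ x, ℓ x * (2 * φ x * fderiv ℝ φ x v) ∂μ := by
  have hφ' : Continuous fun x => fderiv ℝ φ x v :=
    (hφ.continuous_fderiv one_ne_zero).clm_apply continuous_const
  have hφd : Differentiable ℝ φ := hφ.differentiable one_ne_zero
  have hsq (x : E) : fderiv ℝ (fun y => φ y ^ 2) x v = 2 * φ x * fderiv ℝ φ x v := by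
    simp [((hφd x).hasFDerivAt.pow 2).fderiv]
  have hparts := integral_mul_fderiv_eq_neg_fderiv_mul_of_integrable (μ := μ)
    (f := ℓ) (g := fun x => φ x ^ 2) (v := v)
    (integrable_of_forall_eq_zero_imp (by simp only [ℓ.fderiv, hv]; fun_prop) hc
      fun x hx => by simp [hx])
    (integrable_of_forall_eq_zero_imp
      (by simp only [hsq]; exact ℓ.continuous.mul ((continuous_const.mul hφ.continuous).mul hφ'))
      hc fun x hx => by simp [hsq, hx])
    (integrable_of_forall_eq_zero_imp (by fun_prop) hc fun x hx => by simp [hx])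
    (fun _ _ => ℓ.differentiableAt) fun x _ => (hφd x).pow 2
  simp only [ℓ.fderiv, hv, one_mul, hsq] at hparts
  rw [hparts, neg_neg]

theorem integral_sq_le_mul_integral_fderiv_sq (hφ : ContDiff ℝ 1 φ) (hc : HasCompactSupport φ)
    {ℓ : E →L[ℝ] ℝ} {v : E} (hv : ℓ v = 1) {R : ℝ} (hR : ∀ x, φ x ≠ 0 → |ℓ x| ≤ R) :
    ∫ x, φ x ^ 2 ∂μ ≤ 4 * R ^ 2 * ∫ x, fderiv ℝ φ x v ^ 2 ∂μ := by
  have hφ' : Continuous fun x => fderiv ℝ φ x v :=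
    (hφ.continuous_fderiv one_ne_zero).clm_apply continuous_const
  have hint_sq : Integrable (fun x => φ x ^ 2) μ :=
    integrable_of_forall_eq_zero_imp (hφ.continuous.pow 2) hc fun x hx => by simp [hx]
  have hint_fderiv : Integrable (fun x => fderiv ℝ φ x v ^ 2) μ :=
    (hφ'.memLp_of_hasCompactSupport (hc.fderiv_apply ℝ v)).integrable_sq
  have hyoung (x : E) : -(ℓ x * (2 * φ x * fderiv ℝ φ x v)) ≤
      1 / 2 * φ x ^ 2 + 2 * R ^ 2 * fderiv ℝ φ x v ^ 2 := by
    obtain hx | hx := eq_or_ne (φ x) 0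
    · rw [hx]
      nlinarith [mul_nonneg (sq_nonneg R) (sq_nonneg (fderiv ℝ φ x v))]
    · have hℓ : ℓ x ^ 2 ≤ R ^ 2 := sq_le_sq' (abs_le.1 (hR x hx)).1 (abs_le.1 (hR x hx)).2
      nlinarith [sq_nonneg (φ x + 2 * ℓ x * fderiv ℝ φ x v),
        mul_le_mul_of_nonneg_right hℓ (sq_nonneg (fderiv ℝ φ x v))]
  have habsorb : ∫ x, φ x ^ 2 ∂μ ≤
      1 / 2 * ∫ x, φ x ^ 2 ∂μ + 2 * R ^ 2 * ∫ x, fderiv ℝ φ x v ^ 2 ∂μ := calc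
    ∫ x, φ x ^ 2 ∂μ = ∫ x, -(ℓ x * (2 * φ x * fderiv ℝ φ x v)) ∂μ := by
      rw [integral_neg, integral_sq_eq_neg_integral_mul_fderiv hφ hc hv]
    _ ≤ ∫ x, (1 / 2 * φ x ^ 2 + 2 * R ^ 2 * fderiv ℝ φ x v ^ 2) ∂μ :=
      integral_mono
        (integrable_of_forall_eq_zero_imp (by fun_prop) hc fun x hx => by simp [hx])
        ((hint_sq.const_mul _).add (hint_fderiv.const_mul _)) hyoung
    _ = 1 / 2 * ∫ x, φ x ^ 2 ∂μ + 2 * R ^ 2 * ∫ x, fderiv ℝ φ x v ^ 2 ∂μ := by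
      rw [integral_add (hint_sq.const_mul _) (hint_fderiv.const_mul _), integral_const_mul,
        integral_const_mul]
  linarith

end Poincare

variable {d : ℕ} {Ω : Set (EuclideanSpace ℝ (Fin d))}

section Sobolev

-- Shortcut instances: the search does not find the structures on `H1 Ω →L[ℝ] Hneg1 Ω` by itself.
instance : NormedAddCommGroup (H1 Ω) := (H1 Ω).normedAddCommGroup

instance : InnerProductSpace ℝ (H1 Ω) := (H1 Ω).innerProductSpace

instance : NormedAddCommGroup (H10 Ω) := (H10 Ω).normedAddCommGroup

instance : InnerProductSpace ℝ (H10 Ω) := (H10 Ω).innerProductSpace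

instance : NormedAddCommGroup (Hneg1 Ω) := ContinuousLinearMap.toNormedAddCommGroup

instance : NormedSpace ℝ (Hneg1 Ω) := ContinuousLinearMap.toNormedSpace

theorem isClosed_H1 (Ω : Set (EuclideanSpace ℝ (Fin d))) :
    IsClosed (H1 Ω : Set (WithLp 2 (L2 Ω × L2vec Ω))) := by
  have hH1 : (H1 Ω : Set (WithLp 2 (L2 Ω × L2vec Ω))) =
      ⋂ (φ) (_ : IsTest Ω φ) (i : Fin d), {p | ∫ x in Ω, p.fst x * partialDeriv i φ x =
        -∫ x in Ω, p.snd x i * φ x} := by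
    ext p
    simp only [Set.mem_iInter]
    rfl
  rw [hH1]
  refine isClosed_iInter fun φ => isClosed_iInter fun hφ => isClosed_iInter fun i =>
    isClosed_eq ?_ ?_
  · exact (continuous_integral_bilin (ContinuousLinearMap.mul ℝ ℝ)
      (hφ.partialDeriv_memLp i)).comp (WithLp.fstL 2 ℝ (L2 Ω) (L2vec Ω)).continuous
  · exact ((continuous_integral_bilin
      (ContinuousLinearMap.mul ℝ ℝ ∘L EuclideanSpace.proj i) hφ.memLp).comp
        (WithLp.sndL 2 ℝ (L2 Ω) (L2vec Ω)).continuous).neg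

instance : CompleteSpace (H1 Ω) := (isClosed_H1 Ω).completeSpace_coe

instance : CompleteSpace (H10 Ω) :=
  (testSubmodule Ω).isClosed_topologicalClosure.completeSpace_coe

/-- The embedding `H¹(Ω) → L²(Ω)` as a continuous linear map. -/
def H1.valL (Ω : Set (EuclideanSpace ℝ (Fin d))) : H1 Ω →L[ℝ] L2 Ω :=
  WithLp.fstL 2 ℝ (L2 Ω) (L2vec Ω) ∘L (H1 Ω).subtypeL

/-- The weak gradient `H¹(Ω) → [L²(Ω)]^d` as a continuous linear map. -/
def H1.gradL (Ω : Set (EuclideanSpace ℝ (Fin d))) : H1 Ω →L[ℝ] L2vec Ω :=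
  WithLp.sndL 2 ℝ (L2 Ω) (L2vec Ω) ∘L (H1 Ω).subtypeL

theorem H1.norm_sq_eq (y : H1 Ω) : ‖y‖ ^ 2 = ‖H1.val y‖ ^ 2 + ‖H1.grad y‖ ^ 2 :=
  WithLp.prod_norm_sq_eq_of_L2 y.1

theorem fderiv_apply_eq_sum_mul_partialDeriv (φ : EuclideanSpace ℝ (Fin d) → ℝ)
    (x e : EuclideanSpace ℝ (Fin d)) : fderiv ℝ φ x e = ∑ i, e i * partialDeriv i φ x := by
  conv_lhs => rw [← (EuclideanSpace.basisFun (Fin d) ℝ).sum_repr e]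
  simp [partialDeriv]

theorem IsTest.setIntegral_sq_le {φ : EuclideanSpace ℝ (Fin d) → ℝ} (hφ : IsTest Ω φ)
    {e : EuclideanSpace ℝ (Fin d)} (he : ‖e‖ = 1) {R : ℝ} (hR : ∀ x ∈ Ω, |inner ℝ e x| ≤ R) :
    ∫ x in Ω, φ x ^ 2 ≤ 4 * R ^ 2 * ∫ x in Ω, fderiv ℝ φ x e ^ 2 := by
  have hφ_zero (x) (hx : x ∉ Ω) : φ x = 0 :=
    image_eq_zero_of_notMem_tsupport fun h => hx (hφ.supp h)
  have hfderiv_zero (x) (hx : x ∉ Ω) : fderiv ℝ φ x = 0 :=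
    image_eq_zero_of_notMem_tsupport fun h => hx (hφ.supp (tsupport_fderiv_subset ℝ h))
  rw [setIntegral_eq_integral_of_forall_compl_eq_zero fun x hx => by simp [hφ_zero x hx],
    setIntegral_eq_integral_of_forall_compl_eq_zero fun x hx => by simp [hfderiv_zero x hx]]
  exact integral_sq_le_mul_integral_fderiv_sq (ℓ := innerSL ℝ e) (hφ.smooth.of_le (by simp))
    hφ.compact (by simp [he]) fun x hx => hR x (by_contra fun h => hx (hφ_zero x h))

theorem H10.norm_val_sq_le {e : EuclideanSpace ℝ (Fin d)} (he : ‖e‖ = 1) {R : ℝ}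
    (hR : ∀ x ∈ Ω, |inner ℝ e x| ≤ R) (y : H10 Ω) :
    ‖H1.val (y : H1 Ω)‖ ^ 2 ≤ 4 * R ^ 2 * ‖H1.grad (y : H1 Ω)‖ ^ 2 := by
  have hclosed : IsClosed {z : H1 Ω | ‖H1.valL Ω z‖ ^ 2 ≤ 4 * R ^ 2 * ‖H1.gradL Ω z‖ ^ 2} :=
    isClosed_le (by fun_prop) (by fun_prop)
  refine closure_minimal (s := (testSubmodule Ω : Set (H1 Ω))) ?_ hclosed y.2
  rintro z ⟨φ, hφ, hval, hgrad⟩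
  have hdir : ∀ᵐ x ∂vol Ω, fderiv ℝ φ x e = inner ℝ e (H1.grad z x) := by
    filter_upwards [hgrad] with x hx
    simp [fderiv_apply_eq_sum_mul_partialDeriv, PiLp.inner_apply, hx, mul_comm]
  calc ‖H1.val z‖ ^ 2 = ∫ x in Ω, φ x ^ 2 := by
        rw [norm_sq_eq_integral_norm_sq]
        refine integral_congr_ae ?_
        filter_upwards [hval] with x hx
        rw [hx, Real.norm_eq_abs, sq_abs]
    _ ≤ 4 * R ^ 2 * ∫ x in Ω, fderiv ℝ φ x e ^ 2 := hφ.setIntegral_sq_le he hR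
    _ ≤ 4 * R ^ 2 * ‖H1.grad z‖ ^ 2 := by
        refine mul_le_mul_of_nonneg_left ?_ (by positivity)
        rw [norm_sq_eq_integral_norm_sq]
        refine integral_mono_of_nonneg (.of_forall fun x => sq_nonneg _)
          (Lp.memLp (H1.grad z)).norm.integrable_sq ?_
        filter_upwards [hdir] with x hx
        rw [hx]
        refine sq_le_sq' (abs_le.1 ?_).1 (abs_le.1 ?_).2 <;>
          simpa [he] using abs_real_inner_le_norm e (H1.grad z x)

theorem H10.norm_sq_le {e : EuclideanSpace ℝ (Fin d)} (he : ‖e‖ = 1) {R : ℝ}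
    (hR : ∀ x ∈ Ω, |inner ℝ e x| ≤ R) (y : H10 Ω) :
    ‖y‖ ^ 2 ≤ (4 * R ^ 2 + 1) * ‖H1.grad (y : H1 Ω)‖ ^ 2 := by
  rw [Submodule.coe_norm, H1.norm_sq_eq]
  linarith [H10.norm_val_sq_le he hR y]

end Sobolev

section StateEquation

/-- The operator `v ↦ -div v` from `[L²(Ω)]^d` to `H⁻¹(Ω)`. -/
def negDiv (Ω : Set (EuclideanSpace ℝ (Fin d))) : L2vec Ω →L[ℝ] Hneg1 Ω :=
  (H1.gradL Ω ∘L (H10 Ω).subtypeL).precomp ℝ ∘L innerSL ℝ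

/-- The operator `y ↦ -div(u ∇y)` from `H¹(Ω)` to `H⁻¹(Ω)`, as a continuous linear function of the
coefficient `u`. -/
def ellipticOp (Ω : Set (EuclideanSpace ℝ (Fin d))) : Linf Ω →L[ℝ] H1 Ω →L[ℝ] Hneg1 Ω :=
  (negDiv Ω).postcomp (H1 Ω) ∘L (H1.gradL Ω).precomp (L2vec Ω) ∘L
    mulL (vol Ω) (EuclideanSpace ℝ (Fin d))

theorem ellipticOp_apply (u : Linf Ω) (y : H1 Ω) (φ : H10 Ω) :
    ellipticOp Ω u y φ = ∫ x in Ω, u x * inner ℝ (H1.grad y x) (H1.grad (φ : H1 Ω) x) :=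
  inner_mulL u (H1.grad y) (H1.grad (φ : H1 Ω))

/-- The restriction of `ellipticOp Ω u` to `H¹₀(Ω)`: the operator of the Dirichlet problem with
homogeneous boundary values. -/
def dirichletOp (u : Linf Ω) : H10 Ω →L[ℝ] Hneg1 Ω :=
  ellipticOp Ω u ∘L (H10 Ω).subtypeL

theorem continuous_dirichletOp : Continuous (dirichletOp (Ω := Ω)) :=
  (ellipticOp Ω).continuous.clm_comp continuous_const

theorem isCoercive_dirichletOp {e : EuclideanSpace ℝ (Fin d)} (he : ‖e‖ = 1) {R : ℝ}
    (hR : ∀ x ∈ Ω, |inner ℝ e x| ≤ R) {m : ℝ} (hm : 0 < m) {u : Linf Ω}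
    (hu : ∀ᵐ x ∂vol Ω, m ≤ u x) : IsCoercive (dirichletOp u) := by
  have hC : 0 < 4 * R ^ 2 + 1 := by positivity
  refine ⟨m / (4 * R ^ 2 + 1), div_pos hm hC, fun z => ?_⟩
  calc m / (4 * R ^ 2 + 1) * ‖z‖ * ‖z‖ = m / (4 * R ^ 2 + 1) * ‖z‖ ^ 2 := by ring
    _ ≤ m / (4 * R ^ 2 + 1) * ((4 * R ^ 2 + 1) * ‖H1.grad (z : H1 Ω)‖ ^ 2) :=
      mul_le_mul_of_nonneg_left (H10.norm_sq_le he hR z) (div_pos hm hC).le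
    _ = m * ‖H1.grad (z : H1 Ω)‖ ^ 2 := by field_simp
    _ ≤ dirichletOp u z z := mul_norm_sq_le_inner_mulL_self hu _

/-- The control-to-state map `u ↦ y` of the problem `-div(u ∇y) = f` in `Ω`, `y = G` on `∂Ω`. It has
a meaning only where `dirichletOp u` is invertible: elsewhere `ContinuousLinearMap.inverse` is `0`
and the value is `G`. -/
def stateMap (f : Hneg1 Ω) (G : H1 Ω) (u : Linf Ω) : H1 Ω :=
  G + ((dirichletOp u).inverse (f - ellipticOp Ω u G) : H10 Ω)

theorem trace_eq_trace_iff {y G : H1 Ω} : trace Ω y = trace Ω G ↔ ∃ z : H10 Ω, y = G + z := by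
  rw [trace, Submodule.mkQ_apply, Submodule.mkQ_apply, Submodule.Quotient.eq]
  refine ⟨fun h => ⟨⟨y - G, h⟩, (add_sub_cancel G y).symm⟩, ?_⟩
  rintro ⟨z, rfl⟩
  simp

theorem isState_trace_iff_eq_stateMap {f : Hneg1 Ω} {G y : H1 Ω} {u : Linf Ω}
    (hu : (dirichletOp u).IsInvertible) :
    IsState f (trace Ω G) u y ↔ y = stateMap f G u := by
  have hsolve (z : H10 Ω) : ellipticOp Ω u (G + z) = f ↔ G + (z : H1 Ω) = stateMap f G u := by
    rw [stateMap, add_right_inj, SetLike.coe_eq_coe, eq_comm (a := z), hu.inverse_apply_eq,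
      map_add, sub_eq_iff_eq_add', eq_comm]
    rfl
  have hstate : IsState f (trace Ω G) u y ↔ ellipticOp Ω u y = f ∧ ∃ z : H10 Ω, y = G + z := by
    simp only [IsState, trace_eq_trace_iff, ContinuousLinearMap.ext_iff, ellipticOp_apply]
  rw [hstate]
  constructor
  · rintro ⟨hy, z, rfl⟩
    exact (hsolve z).1 hy
  · rintro rfl
    exact ⟨(hsolve _).2 rfl, _, rfl⟩

theorem continuousAt_stateMap (f : Hneg1 Ω) (G : H1 Ω) {u : Linf Ω}
    (hu : (dirichletOp u).IsInvertible) : ContinuousAt (stateMap f G) u := by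
  have hinverse : ContinuousAt (fun v => (dirichletOp v).inverse) u :=
    (hu.contDiffAt_map_inverse (n := 0)).continuousAt.comp continuous_dirichletOp.continuousAt
  have hsource : Continuous fun v => f - ellipticOp Ω v G := by fun_prop
  exact continuousAt_const.add
    (continuous_subtype_val.continuousAt.comp (hinverse.clm_apply hsource.continuousAt))

end StateEquation

section Feasible

variable {F : Submodule ℝ (Linf Ω)} {m M : ℝ}

theorem admissible_eq_preimage_Icc (F : Submodule ℝ (Linf Ω)) (m M : ℝ) :
    admissible F m M = (↑) ⁻¹' Set.Icc ((memLp_top_const m).toLp : Linf Ω)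
      (memLp_top_const M).toLp := by
  ext u
  rw [admissible, Set.mem_ofPred_eq, Set.mem_preimage, Set.mem_Icc, ← Lp.coeFn_le, ← Lp.coeFn_le]
  refine Filter.eventually_and.trans (and_congr ?_ ?_)
  · exact Filter.eventually_congr ((memLp_top_const m).coeFn_toLp.mono fun x hx => by rw [hx])
  · exact Filter.eventually_congr ((memLp_top_const M).coeFn_toLp.mono fun x hx => by rw [hx])

theorem isCompact_admissible (F : Submodule ℝ (Linf Ω)) [FiniteDimensional ℝ F] (m M : ℝ) :
    IsCompact (admissible F m M) := by
  rw [admissible_eq_preimage_Icc]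
  exact isCompact_subtype_val_preimage_Icc F _ _

theorem isInvertible_dirichletOp_of_mem_admissible {e : EuclideanSpace ℝ (Fin d)} (he : ‖e‖ = 1)
    {R : ℝ} (hR : ∀ x ∈ Ω, |inner ℝ e x| ≤ R) (hm : 0 < m) {u : F} (hu : u ∈ admissible F m M) :
    (dirichletOp (u : Linf Ω)).IsInvertible :=
  isInvertible_of_isCoercive
    (isCoercive_dirichletOp he hR hm (Filter.Eventually.mono hu fun _ hx => hx.1))

theorem feasible_eq_image_stateMap {e : EuclideanSpace ℝ (Fin d)} (he : ‖e‖ = 1) {R : ℝ}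
    (hR : ∀ x ∈ Ω, |inner ℝ e x| ≤ R) (hm : 0 < m) (f : Hneg1 Ω) (G : H1 Ω) :
    feasible F m M f (trace Ω G) =
      (fun u : F => (stateMap f G u, u)) '' admissible F m M := by
  ext ⟨y, u⟩
  have hstate (hu : u ∈ admissible F m M) : IsState f (trace Ω G) u y ↔ y = stateMap f G u :=
    isState_trace_iff_eq_stateMap (isInvertible_dirichletOp_of_mem_admissible he hR hm hu)
  constructor
  · rintro ⟨hu, hy⟩
    exact ⟨u, hu, Prod.ext ((hstate hu).1 hy).symm rfl⟩
  · rintro ⟨u, hu, ⟨⟩⟩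
    exact ⟨hu, (hstate hu).2 rfl⟩

theorem feasible_nonempty {e : EuclideanSpace ℝ (Fin d)} (he : ‖e‖ = 1) {R : ℝ}
    (hR : ∀ x ∈ Ω, |inner ℝ e x| ≤ R) (hm : 0 < m) (hU : (admissible F m M).Nonempty)
    (f : Hneg1 Ω) (g : HHalf Ω) : (feasible F m M f g).Nonempty := by
  obtain ⟨G, rfl⟩ := (H10 Ω).mkQ_surjective g
  exact feasible_eq_image_stateMap he hR hm f G ▸ hU.image _

theorem isCompact_feasible {e : EuclideanSpace ℝ (Fin d)} (he : ‖e‖ = 1) {R : ℝ}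
    (hR : ∀ x ∈ Ω, |inner ℝ e x| ≤ R) [FiniteDimensional ℝ F] (hm : 0 < m) (f : Hneg1 Ω)
    (g : HHalf Ω) : IsCompact (feasible F m M f g) := by
  obtain ⟨G, rfl⟩ := (H10 Ω).mkQ_surjective g
  refine feasible_eq_image_stateMap he hR hm f G ▸
    (isCompact_admissible F m M).image_of_continuousOn fun u hu => ?_
  have hstate : ContinuousAt (stateMap f G) (u : Linf Ω) :=
    continuousAt_stateMap f G (isInvertible_dirichletOp_of_mem_admissible he hR hm hu)
  exact ((ContinuousAt.comp (f := ((↑) : F → Linf Ω)) hstate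
    continuous_subtype_val.continuousAt).prodMk continuousAt_id).continuousWithinAt

end Feasible

section Cost

theorem continuous_partialNetwork {N : ℕ} {n : ℕ → ℕ} {ρ : ℝ → ℝ} (hρ : Continuous ρ)
    (w : Weights N n) (l : ℕ) (hl : l < N) : Continuous (partialNetwork ρ w l hl) := by
  induction l with
  | zero => exact (w ⟨0, hl⟩).continuous_of_finiteDimensional
  | succ l ih =>
    exact (w ⟨l + 1, hl⟩).continuous_of_finiteDimensional.comp
      (continuous_pi fun i => hρ.comp ((continuous_apply i).comp (ih _)))

variable {F : Submodule ℝ (Linf Ω)} {L : ℕ} {n : ℕ → ℕ} (b : Module.Basis (Fin (n 0)) ℝ F)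
  {ρ : ℝ → ℝ}

theorem continuous_regularizer (hρ : Continuous ρ) (w : Weights (L + 1) n) :
    Continuous (regularizer b ρ w) := by
  have : FiniteDimensional ℝ F := b.finiteDimensional_of_finite
  exact (continuous_partialNetwork hρ w L (Nat.lt_succ_self L)).comp
    (b.equivFun : F →ₗ[ℝ] Fin (n 0) → ℝ).continuous_of_finiteDimensional

theorem continuous_cost (hρ : Continuous ρ) (w : Weights (L + 1) n)
    {γ : (Fin (n (L + 1)) → ℝ) → ℝ} (hγ : Continuous γ) (yd : L2 Ω) :
    Continuous (cost b ρ γ yd w) := by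
  have hval : Continuous fun p : H1 Ω × F => H1.val p.1 :=
    (H1.valL Ω).continuous.comp continuous_fst
  have hreg := continuous_regularizer b hρ w
  unfold cost
  fun_prop

end Cost

end Conductivity

end

open Conductivity in
theorem mainTheorem9_general {d : ℕ} {Ω : Set (EuclideanSpace ℝ (Fin d))}
    {e : EuclideanSpace ℝ (Fin d)} (he : ‖e‖ = 1) {R : ℝ} (hR : ∀ x ∈ Ω, |inner ℝ e x| ≤ R)
    {m M : ℝ} (hm : 0 < m) {F : Submodule ℝ (Linf Ω)} [FiniteDimensional ℝ F]
    (hU : (admissible F m M).Nonempty) (f : Hneg1 Ω) (g : HHalf Ω) {J : H1 Ω × F → ℝ}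
    (hJ : LowerSemicontinuousOn J (feasible F m M f g)) :
    ∃ p ∈ feasible F m M f g, IsMinOn J (feasible F m M f g) p :=
  hJ.exists_isMinOn (feasible_nonempty he hR hm hU f g) (isCompact_feasible he hR hm f g)

theorem mainTheorem9 {d : ℕ} (hd : 1 ≤ d) (Ω : Set (EuclideanSpace ℝ (Fin d)))
    (hΩ : IsOpen Ω) (hΩb : Bornology.IsBounded Ω)
    (m M : ℝ) (hm : 0 < m) (hmM : m < M)
    (L : ℕ) (n : ℕ → ℕ)
    (F : Submodule ℝ (Conductivity.Linf Ω)) (b : Module.Basis (Fin (n 0)) ℝ F)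
    (hU : (Conductivity.admissible F m M).Nonempty)
    (f : Conductivity.Hneg1 Ω) (g : Conductivity.HHalf Ω) (yd : Conductivity.L2 Ω)
    (ρ : ℝ → ℝ) (hρ : ContDiff ℝ 2 ρ)
    (γ : (Fin (n (L + 1)) → ℝ) → ℝ) (hγ : Continuous γ)
    (w : Conductivity.Weights (L + 1) n) :
    ∃ p ∈ Conductivity.feasible F m M f g,
      IsMinOn (Conductivity.cost b ρ γ yd w) (Conductivity.feasible F m M f g) p := by
  have : FiniteDimensional ℝ F := b.finiteDimensional_of_finite
  obtain ⟨R, hR⟩ := hΩb.exists_norm_le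
  have he : ‖EuclideanSpace.single (⟨0, hd⟩ : Fin d) (1 : ℝ)‖ = 1 := by simp
  have hslab : ∀ x ∈ Ω, |inner ℝ (EuclideanSpace.single (⟨0, hd⟩ : Fin d) (1 : ℝ)) x| ≤ R :=
    fun x hx => (abs_real_inner_le_norm _ x).trans (by simpa [he] using hR x hx)
  have hcost := Conductivity.continuous_cost b hρ.continuous w hγ yd
  exact mainTheorem9_general he hslab hm hU f g (hcost.lowerSemicontinuous.lowerSemicontinuousOn _)
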